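/- Let $K$ be a (commutative) field. An ordering of $K$ is a subset $P\subset K$ with $P+P\subseteq P$, $P\cdot P\subseteq P$, $-1\notin P$ and $P\cup -P=K$; write $a\le_P b$ for $b-a\in P$. For an ordering $P$ put $A(P)=\{a\in K\mid \exists r\in\mathbb{Q},\ -r\le_P a\le_P r\}$. The $\mathbb{R}$-place associated with $P$ is the map $\lambda_P:K\to\mathbb{R}\cup\{\infty\}$ given by $\lambda_P(a)=\infty$ if $a\notin A(P)$ and $\lambda_P(a)=\inf\{r\in\mathbb{Q}\mid a\le_P r\}$ if $a\in A(P)$. Let $M(K)$ be the set of all $\lambda_P$, $P$ an ordering of $K$, with the coarsest topology for which all evaluation maps $M(K)\to\mathbb{R}\cup\{\infty\}$, $\lambda\mapsto\lambda(a)$ $(a\in K)$, are continuous, where $\mathbb{R}\cup\{\infty\}$ is the one-point compactification of $\mathbb{R}$. Let $\sum K^4$ be the set of finite sums of fourth powers of elements of $K$. **Theorem (Becker–Gondard).** For all orderings $P,Q$ of $K$, the $\mathbb{R}$-places $\lambda_P$ and $\lambda_Q$ lie in two distinct connected components of $M(K)$ if and only if there exists $b\in K^{*}$ such that $b\in P\cap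 -Q$ and $b^{2}\in\sum K^{4}$. -/

import Mathlib

/-- The space `χ(K)` of orderings of a field `K`: the subsets `P` of `K` with `P + P ⊆ P`,
`P * P ⊆ P`, `-1 ∉ P` and `P ∪ -P = K`. (For a field, the remaining fields of Mathlib's notion,
that `P` contains the squares and has prime support, follow from these.) -/
def FieldOrdering (K : Type*) [Field K] : Type _ :=
  {P : RingPreordering K // P.IsOrdering}

namespace FieldOrdering

variable {K : Type*} [Field K]

/-- The set of elements of `K` that are nonnegative for the ordering. -/
def nonneg (P : FieldOrdering K) : Set K := {a | a ∈ P.1}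

/-- `P.le a b` is the relation `a ≤ b` for the ordering `P`. -/
def le (P : FieldOrdering K) (a b : K) : Prop := b - a ∈ P.nonneg

/-- The valuation ring `A(P)`: the convex hull of `ℚ` in `K` for the ordering `P`. -/
def finiteElements (P : FieldOrdering K) : Set K :=
  {a | ∃ r : ℚ, P.le (-(r : K)) a ∧ P.le a (r : K)}

open Classical in
/-- The `ℝ`-place `λ_P : K → ℝ ∪ {∞}` of the ordering `P`: it sends `a` to `∞` if `a ∉ A(P)` and to
`inf {r ∈ ℚ | a ≤ r}` if `a ∈ A(P)`. (In the second case this set is nonempty and bounded below.) -/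
noncomputable def realPlace (P : FieldOrdering K) (a : K) : OnePoint ℝ :=
  if a ∈ P.finiteElements then
    ((sInf ((fun r : ℚ => (r : ℝ)) '' {r : ℚ | P.le a (r : K)}) : ℝ) : OnePoint ℝ)
  else OnePoint.infty

end FieldOrdering

/-- The space `M(K)` of `ℝ`-places of `K`: the set of all `λ_P`, for `P` an ordering of `K`. -/
def RealPlaceSpace (K : Type*) [Field K] : Type _ :=
  {l : K → OnePoint ℝ // ∃ P : FieldOrdering K, P.realPlace = l}

namespace RealPlaceSpace

variable {K : Type*} [Field K]

/-- The evaluation `e_a : M(K) → ℝ ∪ {∞}`. -/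
def eval (a : K) (l : RealPlaceSpace K) : OnePoint ℝ := l.1 a

/-- The coarsest topology on `M(K)` for which all evaluations `e_a` are continuous, where `ℝ ∪ {∞}`
is the one-point compactification of `ℝ`. -/
instance : TopologicalSpace (RealPlaceSpace K) :=
  ⨅ a : K, TopologicalSpace.induced (eval a) inferInstance

/-- The map `Λ : χ(K) → M(K)` sending `P` to `λ_P`. -/
noncomputable def ofOrdering (P : FieldOrdering K) : RealPlaceSpace K := ⟨P.realPlace, P, rfl⟩

end RealPlaceSpace

/-- The set `ΣK⁴` of finite sums of fourth powers of elements of `K`. -/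
def sumsOfFourthPowers (K : Type*) [Field K] : AddSubmonoid K :=
  AddSubmonoid.closure (Set.range fun x : K => x ^ 4)

/-!
The sign of `b` at an ordering `P` is compared with the sign of the real place `λ_P` at a suitable
element, and the space of real places is studied through the real holomorphy ring `H`, the ring of
elements at which every real place is finite. On `H` every place `λ_P` is a ring homomorphism to
`ℝ`, namely the standard part for the order of `P`.

If `b ^ 2 = ∑ xᵢ ^ 4`, let `s = ∑ xᵢ ^ 2`. Then `b ^ 2 ≤ s ^ 2 ≤ n * b ^ 2` in every ordering for
some `n`, so `u = b / s` is a unit of `H`, and evaluation at `u` is a continuous function without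
zeros. Its positivity set is clopen and contains `λ_P` exactly when `b` is positive at `P`
(`FieldOrdering.exists_unit_of_sq_mem_sumsOfFourthPowers`).

Conversely, the space of real places is Hausdorff by its definition and compact because an
ultrafilter of orderings has a limit ordering, along which the places converge
(`FieldOrdering.tendsto_realPlace_ultrafilterLimit`). Hence distinct components are separated by a
clopen set `U`. The ring `H` separates places, since the value at `a` is determined by those at
`1 / (1 + a ^ 2)` and `a / (1 + a ^ 2)`, and it contains `ℚ`; by Stone–Weierstrass there is `b ∈ H`
whose values are close to `1` on `U` and close to `-1` off `U`
(`RealPlaceSpace.exists_value_close`). So `b ^ 2` lies between `6 / 7` and `8 / 7` in every ordering.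

Such an element is a sum of fourth powers
(`FieldOrdering.mem_sumsOfFourthPowers_of_close_to_one`). An element that is nonnegative in all
orderings is a sum of squares (`FieldOrdering.isSumSq_of_forall_mem`), so if `|x| ≤ m` everywhere,
Hilbert's identity makes `3 * m ^ 4 - 2 * x ^ 4` a sum of fourth powers. Thus the negative of a
bounded fourth power is a sum of fourth powers up to a constant. Any `e` is a rational combination of
the fourth powers of `1 ± e` and `1 ± 2 * e`, and when `|e| ≤ 1` everywhere this shows that `7 + e`
is a sum of fourth powers.
-/

/-! ### Orderings containing a given preordering -/

namespace RingPreordering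

variable {K : Type*} [Field K]

/-- For a preordering `T` of a field and `a ∉ T`, the preordering `T - a T`. That it omits `-1` is
the only point: `-1 = s - a * t` with `s, t ∈ T` would give `a = (1 + s) / t ∈ T`. -/
def adjoinNeg (T : RingPreordering K) (a : K) (ha : a ∉ T) : RingPreordering K :=
  .mk' {x | ∃ s ∈ T, ∃ t ∈ T, x = s - a * t}
    (by
      rintro _ _ ⟨s, hs, t, ht, rfl⟩ ⟨s', hs', t', ht', rfl⟩
      exact ⟨s + s', add_mem hs hs', t + t', add_mem ht ht', by ring⟩)
    (by
      rintro _ _ ⟨s, hs, t, ht, rfl⟩ ⟨s', hs', t', ht', rfl⟩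
      exact ⟨s * s' + a ^ 2 * (t * t'),
        add_mem (mul_mem hs hs') (mul_mem (T.pow_two_mem a) (mul_mem ht ht')),
        s * t' + s' * t, add_mem (mul_mem hs ht') (mul_mem hs' ht), by ring⟩)
    (fun x => ⟨x * x, T.mul_self_mem x, 0, zero_mem T, by ring⟩)
    (by
      rintro ⟨s, hs, t, ht, h⟩
      have ht0 : t ≠ 0 := by
        rintro rfl
        exact T.neg_one_notMem (by rw [h]; simpa using hs)
      refine ha ?_
      have key : a = (1 + s) * t⁻¹ := by
        rw [eq_mul_inv_iff_mul_eq₀ ht0]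
        linear_combination h
      rw [key]
      exact mul_mem (add_mem (one_mem T) hs) (inv_mem ht))

lemma le_adjoinNeg (T : RingPreordering K) {a : K} (ha : a ∉ T) : T ≤ T.adjoinNeg a ha :=
  fun s hs => ⟨s, hs, 0, zero_mem T, by ring⟩

lemma neg_mem_adjoinNeg (T : RingPreordering K) {a : K} (ha : a ∉ T) : -a ∈ T.adjoinNeg a ha :=
  ⟨0, zero_mem T, 1, one_mem T, by ring⟩

lemma exists_upper_bound_of_isChain {c : Set (RingPreordering K)} (hc : IsChain (· ≤ ·) c)
    {T : RingPreordering K} (hT : T ∈ c) : ∃ U : RingPreordering K, ∀ S ∈ c, S ≤ U := by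
  have key : ∀ S ∈ c, ∀ S' ∈ c, ∃ U ∈ c, S ≤ U ∧ S' ≤ U := fun S hS S' hS' =>
    (hc.total hS hS').elim (fun h => ⟨S', hS', h, le_rfl⟩) (fun h => ⟨S, hS, le_rfl, h⟩)
  refine ⟨.mk' {x | ∃ S ∈ c, x ∈ S} ?_ ?_ (fun x => ⟨T, hT, T.mul_self_mem x⟩) ?_,
    fun S hS x hx => ⟨S, hS, hx⟩⟩
  · rintro x y ⟨S, hS, hx⟩ ⟨S', hS', hy⟩
    obtain ⟨U, hU, h, h'⟩ := key S hS S' hS'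
    exact ⟨U, hU, add_mem (h hx) (h' hy)⟩
  · rintro x y ⟨S, hS, hx⟩ ⟨S', hS', hy⟩
    obtain ⟨U, hU, h, h'⟩ := key S hS S' hS'
    exact ⟨U, hU, mul_mem (h hx) (h' hy)⟩
  · rintro ⟨S, -, hS⟩
    exact S.neg_one_notMem hS

/-- Every preordering of a field is contained in an ordering. -/
theorem exists_isOrdering_ge (T : RingPreordering K) :
    ∃ P : RingPreordering K, T ≤ P ∧ P.IsOrdering := by
  obtain ⟨P, hTP, hP⟩ := zorn_le_nonempty_Ici₀ T
    (fun c _ hc y hy => exists_upper_bound_of_isChain hc hy) T le_rfl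
  refine ⟨P, hTP, ?_⟩
  have : HasMemOrNegMem P := ⟨fun a => by
    by_contra! h
    exact h.2 (hP (P.le_adjoinNeg h.1) (P.neg_mem_adjoinNeg h.1))⟩
  exact {}

end RingPreordering

namespace FieldOrdering

variable {K : Type*} [Field K]

lemma mem_or_neg_mem (P : FieldOrdering K) (a : K) : a ∈ P.1 ∨ -a ∈ P.1 :=
  have := P.2
  HasMemOrNegMem.mem_or_neg_mem P.1 a

/-- An element that is nonnegative for every ordering is a sum of squares, provided that there is an
ordering at all. -/
theorem isSumSq_of_forall_mem (P : FieldOrdering K) {a : K}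
    (h : ∀ R : FieldOrdering K, a ∈ R.nonneg) : IsSumSq a := by
  let T : RingPreordering K := .mk' {x | IsSumSq x} (fun hx hy => hx.add hy)
    (fun hx hy => hx.mul hy) (fun x => .mul_self x)
    (fun hx => P.1.neg_one_notMem (RingPreordering.mem_of_isSumSq hx))
  by_contra ha
  change a ∉ T at ha
  obtain ⟨R, hTR, hR⟩ := (T.adjoinNeg a ha).exists_isOrdering_ge
  have h0 : a = 0 := RingPreordering.eq_zero_of_mem_of_neg_mem (P := R) (h ⟨R, hR⟩)
    (hTR (T.neg_mem_adjoinNeg ha))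
  exact ha (h0 ▸ zero_mem T)

/-! ### The linear order and the standard part of an ordering -/

open Classical in
/-- The linear order on `K` whose set of nonnegative elements is the ordering `P`. It is not an
instance, as `K` may have many orderings. -/
noncomputable abbrev linearOrder (P : FieldOrdering K) : LinearOrder K where
  le := P.le
  le_refl a := by
    change a - a ∈ P.1
    simp
  le_trans a b c (hab : b - a ∈ P.1) (hbc : c - b ∈ P.1) := by
    change c - a ∈ P.1
    simpa using add_mem hbc hab
  le_antisymm a b (hab : b - a ∈ P.1) (hba : a - b ∈ P.1) := by
    have := RingPreordering.eq_zero_of_mem_of_neg_mem hba (by simpa using hab)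
    exact sub_eq_zero.1 this
  le_total a b := by
    change b - a ∈ P.1 ∨ a - b ∈ P.1
    simpa using P.mem_or_neg_mem (b - a)
  toDecidableLE := Classical.decRel _

lemma isStrictOrderedRing (P : FieldOrdering K) :
    letI := P.linearOrder
    IsStrictOrderedRing K := by
  let := P.linearOrder
  have hle : ∀ a b : K, a ≤ b ↔ b - a ∈ P.1 := fun a b => Iff.rfl
  have : IsOrderedAddMonoid K :=
    { add_le_add_left := fun a b hab c => by
        rw [hle] at hab ⊢
        simpa using hab }
  have : ZeroLEOneClass K := ⟨by rw [hle]; simp⟩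
  refine .of_mul_pos fun a b ha hb => ?_
  have h : 0 ≤ a * b := by
    have ha' := ha.le
    have hb' := hb.le
    rw [hle, sub_zero] at *
    exact mul_mem ha' hb'
  exact lt_of_le_of_ne h (mul_ne_zero ha.ne' hb.ne').symm

lemma mem_nonneg_iff (P : FieldOrdering K) {a : K} :
    letI := P.linearOrder
    a ∈ P.nonneg ↔ 0 ≤ a := by
  change a ∈ P.1 ↔ a - 0 ∈ P.1
  rw [sub_zero]

lemma mem_finiteElements_iff (P : FieldOrdering K) {a : K} :
    letI := P.linearOrder
    letI := P.isStrictOrderedRing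
    a ∈ P.finiteElements ↔ 0 ≤ ArchimedeanClass.mk a := by
  let := P.linearOrder
  have := P.isStrictOrderedRing
  refine ⟨fun ⟨r, h1, h2⟩ => ?_, fun h => ?_⟩
  · have h1' : -(r : K) ≤ a := h1
    have h2' : a ≤ r := h2
    exact (ArchimedeanClass.mk_ratCast_nonneg r).trans
      (ArchimedeanClass.mk_le_mk_of_abs ((abs_le.2 ⟨h1', h2'⟩).trans (le_abs_self _)))
  · obtain ⟨n, hn⟩ := ArchimedeanClass.exists_nat_ge_of_mk_nonneg (x := |a|) (by simpa using h)
    refine ⟨n, ?_, ?_⟩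
    · change -((n : ℚ) : K) ≤ a
      push_cast
      exact (abs_le.1 hn).1
    · change a ≤ ((n : ℚ) : K)
      push_cast
      exact (abs_le.1 hn).2

/-- The standard part of `a` for the order given by `P`: the value of the place `λ_P` at `a` if `a`
is finite, and `0` otherwise. -/
noncomputable def stdPart (P : FieldOrdering K) (a : K) : ℝ :=
  letI := P.linearOrder
  letI := P.isStrictOrderedRing
  ArchimedeanClass.stdPart a

section

variable (P : FieldOrdering K) {a b : K} {q : ℚ}

lemma stdPart_le_ratCast (ha : a ∈ P.finiteElements) (h : P.le a q) : P.stdPart a ≤ q := by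
  let := P.linearOrder
  have := P.isStrictOrderedRing
  have := ArchimedeanClass.stdPart_monotoneOn (P.mem_finiteElements_iff.1 ha)
    (ArchimedeanClass.mk_ratCast_nonneg q) h
  rwa [ArchimedeanClass.stdPart_ratCast] at this

lemma ratCast_le_stdPart (ha : a ∈ P.finiteElements) (h : P.le q a) : q ≤ P.stdPart a := by
  let := P.linearOrder
  have := P.isStrictOrderedRing
  have := ArchimedeanClass.stdPart_monotoneOn (ArchimedeanClass.mk_ratCast_nonneg q)
    (P.mem_finiteElements_iff.1 ha) h
  rwa [ArchimedeanClass.stdPart_ratCast] at this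

lemma le_total (a b : K) : P.le a b ∨ P.le b a := P.linearOrder.le_total a b

lemma le_ratCast_of_stdPart_lt (ha : a ∈ P.finiteElements) (h : P.stdPart a < q) : P.le a q :=
  (P.le_total a q).resolve_right fun h' => h.not_ge (P.ratCast_le_stdPart ha h')

lemma ratCast_le_of_lt_stdPart (ha : a ∈ P.finiteElements) (h : q < P.stdPart a) : P.le q a :=
  (P.le_total a q).resolve_left fun h' => h.not_ge (P.stdPart_le_ratCast ha h')

lemma realPlace_of_mem (ha : a ∈ P.finiteElements) :
    P.realPlace a = (P.stdPart a : OnePoint ℝ) := by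
  rw [realPlace, if_pos ha]
  congr 1
  have hbdd : ∀ x ∈ (fun r : ℚ => (r : ℝ)) '' {r : ℚ | P.le a r}, P.stdPart a ≤ x := by
    rintro _ ⟨r, hr, rfl⟩
    exact P.stdPart_le_ratCast ha hr
  refine le_antisymm (le_of_forall_gt_imp_ge_of_dense fun c hc => ?_) ?_
  · obtain ⟨q, hq, hqc⟩ := exists_rat_btwn hc
    exact (csInf_le ⟨_, hbdd⟩ ⟨q, P.le_ratCast_of_stdPart_lt ha hq, rfl⟩).trans hqc.le
  · obtain ⟨r, -, hr⟩ := ha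
    exact le_csInf ⟨_, r, hr, rfl⟩ hbdd

lemma realPlace_of_notMem (ha : a ∉ P.finiteElements) : P.realPlace a = OnePoint.infty := by
  rw [realPlace, if_neg ha]

lemma add_mem_finiteElements (ha : a ∈ P.finiteElements) (hb : b ∈ P.finiteElements) :
    a + b ∈ P.finiteElements := by
  let := P.linearOrder
  have := P.isStrictOrderedRing
  rw [mem_finiteElements_iff] at *
  exact (le_min ha hb).trans (ArchimedeanClass.min_le_mk_add _ _)

lemma mul_mem_finiteElements (ha : a ∈ P.finiteElements) (hb : b ∈ P.finiteElements) :
    a * b ∈ P.finiteElements := by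
  let := P.linearOrder
  have := P.isStrictOrderedRing
  rw [mem_finiteElements_iff] at *
  rw [ArchimedeanClass.mk_mul]
  exact add_nonneg ha hb

lemma neg_mem_finiteElements (ha : a ∈ P.finiteElements) : -a ∈ P.finiteElements := by
  let := P.linearOrder
  have := P.isStrictOrderedRing
  rw [mem_finiteElements_iff] at *
  rwa [ArchimedeanClass.mk_neg]

lemma ratCast_mem_finiteElements (q : ℚ) : (q : K) ∈ P.finiteElements := by
  let := P.linearOrder
  have := P.isStrictOrderedRing
  rw [mem_finiteElements_iff]
  exact ArchimedeanClass.mk_ratCast_nonneg q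

lemma stdPart_ratCast (q : ℚ) : P.stdPart (q : K) = q := by
  let := P.linearOrder
  have := P.isStrictOrderedRing
  exact ArchimedeanClass.stdPart_ratCast q

lemma stdPart_add (ha : a ∈ P.finiteElements) (hb : b ∈ P.finiteElements) :
    P.stdPart (a + b) = P.stdPart a + P.stdPart b := by
  let := P.linearOrder
  have := P.isStrictOrderedRing
  rw [mem_finiteElements_iff] at ha hb
  exact ArchimedeanClass.stdPart_add ha hb

lemma stdPart_mul (ha : a ∈ P.finiteElements) (hb : b ∈ P.finiteElements) :
    P.stdPart (a * b) = P.stdPart a * P.stdPart b := by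
  let := P.linearOrder
  have := P.isStrictOrderedRing
  rw [mem_finiteElements_iff] at ha hb
  exact ArchimedeanClass.stdPart_mul ha hb

lemma stdPart_neg (a : K) : P.stdPart (-a) = -P.stdPart a := by
  let := P.linearOrder
  have := P.isStrictOrderedRing
  exact ArchimedeanClass.stdPart_neg a

lemma stdPart_inv (a : K) : P.stdPart a⁻¹ = (P.stdPart a)⁻¹ := by
  let := P.linearOrder
  have := P.isStrictOrderedRing
  exact ArchimedeanClass.stdPart_inv a

lemma mem_finiteElements_of_stdPart_ne_zero (h : P.stdPart a ≠ 0) : a ∈ P.finiteElements := by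
  let := P.linearOrder
  have := P.isStrictOrderedRing
  rw [mem_finiteElements_iff]
  exact (not_not.1 (mt ArchimedeanClass.stdPart_eq_zero.2 h)).ge

lemma mem_nonneg_of_stdPart_pos (h : 0 < P.stdPart a) : a ∈ P.nonneg := by
  have := P.ratCast_le_of_lt_stdPart (q := 0) (P.mem_finiteElements_of_stdPart_ne_zero h.ne')
    (by simpa using h)
  simpa [le] using this

lemma stdPart_nonneg (h : a ∈ P.nonneg) : 0 ≤ P.stdPart a := by
  let := P.linearOrder
  have := P.isStrictOrderedRing
  exact ArchimedeanClass.stdPart_nonneg (P.mem_nonneg_iff.1 h)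

end

end FieldOrdering

/-! ### Sums of fourth powers -/

section FourthPowers

variable {K : Type*} [Field K]

lemma pow_four_mem_sumsOfFourthPowers (x : K) : x ^ 4 ∈ sumsOfFourthPowers K :=
  AddSubmonoid.subset_closure ⟨x, rfl⟩

lemma pow_four_mul_mem_sumsOfFourthPowers (y : K) {x : K} (hx : x ∈ sumsOfFourthPowers K) :
    y ^ 4 * x ∈ sumsOfFourthPowers K := by
  induction hx using AddSubmonoid.closure_induction with
  | mem x hx =>
    obtain ⟨z, rfl⟩ := hx
    simpa [mul_pow] using pow_four_mem_sumsOfFourthPowers (y * z)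
  | zero => simp
  | add x z _ _ hx hz => simpa [mul_add] using add_mem hx hz

lemma natCast_mul_mem_sumsOfFourthPowers (n : ℕ) {x : K} (hx : x ∈ sumsOfFourthPowers K) :
    (n : K) * x ∈ sumsOfFourthPowers K := by
  simpa using nsmul_mem hx n

/-- Positive integers can be cancelled, because `x = n⁻⁴ n³ (n x)`. -/
lemma mem_sumsOfFourthPowers_of_natCast_mul_mem (n : ℕ) (hn : (n : K) ≠ 0) {x : K}
    (hx : (n : K) * x ∈ sumsOfFourthPowers K) : x ∈ sumsOfFourthPowers K := by
  have h := pow_four_mul_mem_sumsOfFourthPowers (n : K)⁻¹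
    (natCast_mul_mem_sumsOfFourthPowers (n ^ 3) hx)
  convert h using 1
  push_cast
  field_simp

/-- Hilbert's identity expressing `3 (x ^ 2 + s) ^ 2 - 2 x ^ 4` through fourth powers when `s` is a
sum of squares. The inductive step averages the claim for `x + y` and `x - y`, which is the claim
for `x` and `s + y ^ 2` up to the summand `2 y ^ 4`. -/
theorem IsSumSq.hilbert_mem_sumsOfFourthPowers [CharZero K] {s : K} (hs : IsSumSq s) (x : K) :
    x ^ 4 + 6 * x ^ 2 * s + 3 * s ^ 2 ∈ sumsOfFourthPowers K := by
  induction hs generalizing x with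
  | zero => simpa using pow_four_mem_sumsOfFourthPowers x
  | @sq_add y s hs ih =>
    refine mem_sumsOfFourthPowers_of_natCast_mul_mem 2 (by norm_num) ?_
    have h := add_mem (add_mem (ih (x + y)) (ih (x - y)))
      (natCast_mul_mem_sumsOfFourthPowers 4 (pow_four_mem_sumsOfFourthPowers y))
    convert h using 1
    push_cast
    ring

lemma IsSumSq.three_mul_sub_mem_sumsOfFourthPowers [CharZero K] {m x : K}
    (h : IsSumSq (m ^ 2 - x ^ 2)) : 3 * m ^ 4 - 2 * x ^ 4 ∈ sumsOfFourthPowers K := by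
  convert h.hilbert_mem_sumsOfFourthPowers x using 1
  ring

namespace FieldOrdering

lemma charZero (P : FieldOrdering K) : CharZero K :=
  let := P.linearOrder
  have := P.isStrictOrderedRing
  inferInstance

/-- Elements that are close to a constant in every ordering are sums of fourth powers. Indeed `e` is
a rational combination of the fourth powers of `1 ± e` and `1 ± 2 e`, and those entering with a
negative sign are compensated by constants. -/
theorem seven_add_mem_sumsOfFourthPowers (P : FieldOrdering K) {e : K}
    (he : ∀ R : FieldOrdering K, R.le (-1) e ∧ R.le e 1) : 7 + e ∈ sumsOfFourthPowers K := by
  have := P.charZero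
  have h1 : IsSumSq ((2 : K) ^ 2 - (1 - e) ^ 2) := by
    refine P.isSumSq_of_forall_mem fun R => ?_
    let := R.linearOrder
    have := R.isStrictOrderedRing
    obtain ⟨hl : -1 ≤ e, hu : e ≤ 1⟩ := he R
    rw [R.mem_nonneg_iff]
    nlinarith
  have h2 : IsSumSq ((3 : K) ^ 2 - (1 + 2 * e) ^ 2) := by
    refine P.isSumSq_of_forall_mem fun R => ?_
    let := R.linearOrder
    have := R.isStrictOrderedRing
    obtain ⟨hl : -1 ≤ e, hu : e ≤ 1⟩ := he R
    rw [R.mem_nonneg_iff]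
    nlinarith
  refine mem_sumsOfFourthPowers_of_natCast_mul_mem 96 (by norm_num) ?_
  have h := add_mem (add_mem (add_mem (add_mem
    (natCast_mul_mem_sumsOfFourthPowers 16 (pow_four_mem_sumsOfFourthPowers (1 + e)))
    (natCast_mul_mem_sumsOfFourthPowers 2 (pow_four_mem_sumsOfFourthPowers (1 - 2 * e))))
    (natCast_mul_mem_sumsOfFourthPowers 8 h1.three_mul_sub_mem_sumsOfFourthPowers))
    h2.three_mul_sub_mem_sumsOfFourthPowers)
    (natCast_mul_mem_sumsOfFourthPowers 45 (pow_four_mem_sumsOfFourthPowers 1))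
  convert h using 1
  push_cast
  ring

theorem mem_sumsOfFourthPowers_of_close_to_one (P : FieldOrdering K) {a : K}
    (ha : ∀ R : FieldOrdering K, R.le (6 / 7 : ℚ) a ∧ R.le a (8 / 7 : ℚ)) :
    a ∈ sumsOfFourthPowers K := by
  have := P.charZero
  refine mem_sumsOfFourthPowers_of_natCast_mul_mem 7 (by norm_num) ?_
  have h : 7 + (7 * a - 7) ∈ sumsOfFourthPowers K := by
    refine P.seven_add_mem_sumsOfFourthPowers fun R => ?_
    let := R.linearOrder
    have := R.isStrictOrderedRing
    obtain ⟨hl, hu⟩ := ha R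
    replace hl : ((6 / 7 : ℚ) : K) ≤ a := hl
    replace hu : a ≤ ((8 / 7 : ℚ) : K) := hu
    push_cast at hl hu
    change -1 ≤ 7 * a - 7 ∧ 7 * a - 7 ≤ 1
    constructor <;> linarith
  simpa using h

/-- A sum of fourth powers is, up to a bounded factor, the square of a sum of squares. -/
theorem exists_sq_bounds_of_mem_sumsOfFourthPowers {c : K} (hc : c ∈ sumsOfFourthPowers K) :
    ∃ (s : K) (n : ℕ), ∀ R : FieldOrdering K,
      c ∈ R.nonneg ∧ s ∈ R.nonneg ∧ R.le c (s ^ 2) ∧ R.le (s ^ 2) (n * c) := by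
  induction hc using AddSubmonoid.closure_induction with
  | mem c hc =>
    obtain ⟨x, rfl⟩ := hc
    have hx : x ^ 4 = (x ^ 2) ^ 2 := by ring
    refine ⟨x ^ 2, 1, fun R => ⟨?_, R.1.pow_two_mem x, ?_, ?_⟩⟩
    · beta_reduce
      rw [hx]
      exact R.1.pow_two_mem (x ^ 2)
    · beta_reduce
      rw [hx]
      exact R.linearOrder.le_refl _
    · beta_reduce
      rw [hx, Nat.cast_one, one_mul]
      exact R.linearOrder.le_refl _
  | zero =>
    refine ⟨0, 0, fun R => ⟨zero_mem R.1, zero_mem R.1, ?_, ?_⟩⟩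
    · rw [zero_pow two_ne_zero]
      exact R.linearOrder.le_refl _
    · rw [zero_pow two_ne_zero, mul_zero]
      exact R.linearOrder.le_refl _
  | add c d _ _ hc hd =>
    obtain ⟨s, n, hs⟩ := hc
    obtain ⟨t, m, ht⟩ := hd
    refine ⟨s + t, 2 * (n + m), fun R => ?_⟩
    let := R.linearOrder
    have := R.isStrictOrderedRing
    obtain ⟨hc, hs0, hs1 : c ≤ s ^ 2, hs2 : s ^ 2 ≤ n * c⟩ := hs R
    obtain ⟨hd, ht0, ht1 : d ≤ t ^ 2, ht2 : t ^ 2 ≤ m * d⟩ := ht R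
    refine ⟨add_mem (S := RingPreordering K) hc hd, add_mem (S := RingPreordering K) hs0 ht0,
      ?_, ?_⟩
    · rw [R.mem_nonneg_iff] at hs0 ht0
      change c + d ≤ (s + t) ^ 2
      nlinarith [mul_nonneg hs0 ht0]
    · rw [R.mem_nonneg_iff] at hc hd
      change (s + t) ^ 2 ≤ ((2 * (n + m) : ℕ) : K) * (c + d)
      have h1 : 0 ≤ (n : K) * d := mul_nonneg n.cast_nonneg hd
      have h2 : 0 ≤ (m : K) * c := mul_nonneg m.cast_nonneg hc
      push_cast
      nlinarith [sq_nonneg (s - t)]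

lemma mem_finiteElements_of_sq_le (R : FieldOrdering K) {a : K} {q : ℚ} (h : R.le (a ^ 2) q) :
    a ∈ R.finiteElements := by
  let := R.linearOrder
  have := R.isStrictOrderedRing
  replace h : a ^ 2 ≤ q := h
  have hq : |a| ≤ (q + 1 : ℚ) := by
    push_cast
    nlinarith [sq_nonneg (|a| - 1), sq_abs a, abs_nonneg a]
  exact ⟨q + 1, (abs_le.1 hq).1, (abs_le.1 hq).2⟩

/-- If `b ^ 2` is a sum of fourth powers, some multiple `u = b / s` of `b` by a totally positive
element is a unit at every real place, so that the sign of `b` at an ordering is the sign of the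
value of the associated place at `u`. -/
theorem exists_unit_of_sq_mem_sumsOfFourthPowers {b : K} (hb : b ≠ 0)
    (h : b ^ 2 ∈ sumsOfFourthPowers K) :
    ∃ u : K, ∀ R : FieldOrdering K, u ∈ R.finiteElements ∧ R.stdPart u ≠ 0 ∧
      (b ∈ R.nonneg → 0 < R.stdPart u) ∧ (-b ∈ R.nonneg → R.stdPart u < 0) := by
  obtain ⟨s, n, hs⟩ := exists_sq_bounds_of_mem_sumsOfFourthPowers h
  refine ⟨b / s, fun R => ?_⟩
  let := R.linearOrder
  have := R.isStrictOrderedRing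
  obtain ⟨-, hs0, hs1, hs2⟩ := hs R
  replace hs1 : b ^ 2 ≤ s ^ 2 := hs1
  replace hs2 : s ^ 2 ≤ n * b ^ 2 := hs2
  have hb2 : 0 < b ^ 2 := by positivity
  have hs2pos : 0 < s ^ 2 := hb2.trans_le hs1
  have hs' : s ≠ 0 := by
    rintro rfl
    simp at hs2pos
  have hfin : b / s ∈ R.finiteElements := by
    refine R.mem_finiteElements_of_sq_le (q := 1) ?_
    change (b / s) ^ 2 ≤ ((1 : ℚ) : K)
    rw [Rat.cast_one, div_pow]
    exact (div_le_one hs2pos).2 hs1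
  have hfin' : s / b ∈ R.finiteElements := by
    refine R.mem_finiteElements_of_sq_le (q := n) ?_
    change (s / b) ^ 2 ≤ ((n : ℚ) : K)
    rw [Rat.cast_natCast, div_pow]
    exact (div_le_iff₀ hb2).2 hs2
  have hne : R.stdPart (b / s) ≠ 0 := by
    intro h0
    have h1 := R.stdPart_mul hfin hfin'
    rw [div_mul_div_cancel₀ hs', div_self hb, h0, zero_mul] at h1
    simpa [h1] using R.stdPart_ratCast 1
  rw [R.mem_nonneg_iff] at hs0
  refine ⟨hfin, hne, fun hbR => ?_, fun hbR => ?_⟩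
  · rw [R.mem_nonneg_iff] at hbR
    exact (R.stdPart_nonneg (R.mem_nonneg_iff.2 (div_nonneg hbR hs0))).lt_of_ne' hne
  · rw [R.mem_nonneg_iff] at hbR
    have h1 := R.stdPart_nonneg (R.mem_nonneg_iff.2 (div_nonneg hbR hs0))
    rw [neg_div, R.stdPart_neg] at h1
    exact (neg_nonneg.1 h1).lt_of_ne hne

end FieldOrdering

end FourthPowers

/-! ### The space of real places is compact and Hausdorff -/

namespace FieldOrdering

variable {K : Type*} [Field K]

/-- The limit of an ultrafilter of orderings: the elements that are nonnegative for almost all of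
them. -/
def ultrafilterLimit (F : Ultrafilter (FieldOrdering K)) : FieldOrdering K where
  val := .mk' {a | ∀ᶠ R : FieldOrdering K in F, a ∈ R.1}
    (fun hx hy => by filter_upwards [hx, hy] with R using add_mem)
    (fun hx hy => by filter_upwards [hx, hy] with R using mul_mem)
    (fun x => Filter.Eventually.of_forall fun R => R.1.mul_self_mem x)
    (fun h => by
      obtain ⟨R, hR⟩ := h.exists
      exact R.1.neg_one_notMem hR)
  property := RingPreordering.isOrdering_iff.2 fun a b h => Ultrafilter.eventually_or.1 <| by
    filter_upwards [h] with R hR using RingPreordering.isOrdering_iff.1 R.2 a b hR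

lemma ultrafilterLimit_le_iff (F : Ultrafilter (FieldOrdering K)) {a b : K} :
    (ultrafilterLimit F).le a b ↔ ∀ᶠ R : FieldOrdering K in F, R.le a b := Iff.rfl

open Filter Topology

theorem tendsto_realPlace_ultrafilterLimit (F : Ultrafilter (FieldOrdering K)) (a : K) :
    Tendsto (fun R : FieldOrdering K => R.realPlace a) F
      (𝓝 ((ultrafilterLimit F).realPlace a)) := by
  by_cases ha : a ∈ (ultrafilterLimit F).finiteElements
  · -- Almost all `R` bound `a` by the same rational, so the values are real and converge in `ℝ`.
    have hfin : ∀ᶠ R : FieldOrdering K in F, a ∈ R.finiteElements := by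
      obtain ⟨r, h1, h2⟩ := ha
      rw [ultrafilterLimit_le_iff] at h1 h2
      filter_upwards [h1, h2] with R h1 h2 using ⟨r, h1, h2⟩
    have hreal : Tendsto (fun R : FieldOrdering K => R.stdPart a) F
        (𝓝 ((ultrafilterLimit F).stdPart a)) := by
      refine tendsto_order.2 ⟨fun x hx => ?_, fun x hx => ?_⟩
      · obtain ⟨q, hxq, hq⟩ := exists_rat_btwn hx
        have := (ultrafilterLimit_le_iff F).1 ((ultrafilterLimit F).ratCast_le_of_lt_stdPart ha hq)
        filter_upwards [hfin, this] with R hR h using hxq.trans_le (R.ratCast_le_stdPart hR h)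
      · obtain ⟨q, hq, hqx⟩ := exists_rat_btwn hx
        have := (ultrafilterLimit_le_iff F).1 ((ultrafilterLimit F).le_ratCast_of_stdPart_lt ha hq)
        filter_upwards [hfin, this] with R hR h using (R.stdPart_le_ratCast hR h).trans_lt hqx
    rw [realPlace_of_mem _ ha]
    refine ((OnePoint.continuous_coe.tendsto _).comp hreal).congr' ?_
    filter_upwards [hfin] with R hR using (R.realPlace_of_mem hR).symm
  · -- No compact subset of `ℝ`, being contained in some `[-q, q]`, can contain almost all values.
    rw [realPlace_of_notMem _ ha, OnePoint.hasBasis_nhds_infty.tendsto_right_iff]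
    rintro s ⟨-, hs⟩
    obtain ⟨x, hx⟩ := hs.isBounded.exists_norm_le
    obtain ⟨q, hq⟩ := exists_rat_gt x
    have hnot : ∀ᶠ R : FieldOrdering K in F, ¬(R.le (-(q : K)) a ∧ R.le a q) := by
      rw [Ultrafilter.eventually_not, eventually_and]
      exact fun h => ha ⟨q, h.1, h.2⟩
    filter_upwards [hnot] with R hR
    by_cases haR : a ∈ R.finiteElements
    · rw [R.realPlace_of_mem haR]
      refine Or.inl ⟨_, fun hmem => hR ?_, rfl⟩
      have h := abs_lt.1 ((hx _ hmem).trans_lt hq)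
      refine ⟨?_, R.le_ratCast_of_stdPart_lt haR h.2⟩
      have := R.ratCast_le_of_lt_stdPart (q := -q) haR (by simpa using h.1)
      simpa using this
    · rw [R.realPlace_of_notMem haR]
      exact Or.inr rfl

end FieldOrdering

namespace RealPlaceSpace

open Filter Topology

variable {K : Type*} [Field K]

lemma continuous_eval (a : K) : Continuous (eval a : RealPlaceSpace K → OnePoint ℝ) :=
  continuous_iInf_dom (i := a) continuous_induced_dom

instance : T2Space (RealPlaceSpace K) :=
  .of_injective_continuous (f := fun (l : RealPlaceSpace K) (a : K) => eval a l)
    (fun _ _ h => Subtype.ext h) (continuous_pi continuous_eval)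

instance : CompactSpace (RealPlaceSpace K) := by
  refine ⟨isCompact_iff_ultrafilter_le_nhds.2 fun G _ => ?_⟩
  choose s hs using fun l : RealPlaceSpace K => l.2
  let P := FieldOrdering.ultrafilterLimit (G.map s)
  refine ⟨ofOrdering P, Set.mem_univ _, ?_⟩
  rw [nhds_iInf]
  refine le_iInf fun a => ?_
  rw [nhds_induced, ← tendsto_iff_comap]
  refine (tendsto_map'_iff.1 (FieldOrdering.tendsto_realPlace_ultrafilterLimit (G.map s) a)).congr
    fun l => ?_
  exact congrFun (hs l) a

/-! ### The real holomorphy ring is dense in the continuous functions -/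

/-- The value of a real place at `a` as a real number, with the junk value `0` where the place is
infinite. -/
noncomputable def value (l : RealPlaceSpace K) (a : K) : ℝ := l.2.choose.stdPart a

/-- The real holomorphy ring of `K`: the elements at which no real place is infinite. -/
def realHolomorphyRing (K : Type*) [Field K] : Subring K where
  carrier := {a | ∀ R : FieldOrdering K, a ∈ R.finiteElements}
  mul_mem' ha hb R := R.mul_mem_finiteElements (ha R) (hb R)
  one_mem' R := by simpa using R.ratCast_mem_finiteElements 1
  add_mem' ha hb R := R.add_mem_finiteElements (ha R) (hb R)
  zero_mem' R := by simpa using R.ratCast_mem_finiteElements 0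
  neg_mem' ha R := R.neg_mem_finiteElements (ha R)

lemma eval_eq_value {a : K} (ha : a ∈ realHolomorphyRing K) (l : RealPlaceSpace K) :
    eval a l = (value l a : OnePoint ℝ) :=
  (congrFun l.2.choose_spec a).symm.trans (FieldOrdering.realPlace_of_mem _ (ha _))

lemma value_ofOrdering {a : K} (ha : a ∈ realHolomorphyRing K) (P : FieldOrdering K) :
    value (ofOrdering P) a = P.stdPart a :=
  OnePoint.coe_injective ((eval_eq_value ha _).symm.trans (P.realPlace_of_mem (ha P)))

lemma continuous_value {a : K} (ha : a ∈ realHolomorphyRing K) :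
    Continuous fun l : RealPlaceSpace K => value l a := by
  rw [OnePoint.isOpenEmbedding_coe.isEmbedding.continuous_iff]
  exact (continuous_eval a).congr (eval_eq_value ha)

/-- The elements of the real holomorphy ring as continuous functions on the space of real places. -/
noncomputable def valueHom (K : Type*) [Field K] :
    realHolomorphyRing K →+* C(RealPlaceSpace K, ℝ) where
  toFun a := ⟨fun l => value l a, continuous_value a.2⟩
  map_one' := by
    ext l
    simpa [value] using l.2.choose.stdPart_ratCast 1
  map_mul' a b := by
    ext l
    exact FieldOrdering.stdPart_mul _ (a.2 _) (b.2 _)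
  map_zero' := by
    ext l
    simpa [value] using l.2.choose.stdPart_ratCast 0
  map_add' a b := by
    ext l
    exact FieldOrdering.stdPart_add _ (a.2 _) (b.2 _)

end RealPlaceSpace

namespace FieldOrdering

variable {K : Type*} [Field K]

lemma inv_one_add_sq_mem_finiteElements (R : FieldOrdering K) (a : K) :
    (1 + a ^ 2)⁻¹ ∈ R.finiteElements := by
  let := R.linearOrder
  have := R.isStrictOrderedRing
  have h : 1 ≤ 1 + a ^ 2 := by nlinarith [sq_nonneg a]
  refine R.mem_finiteElements_of_sq_le (q := 1) ?_
  change ((1 + a ^ 2)⁻¹) ^ 2 ≤ ((1 : ℚ) : K)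
  rw [Rat.cast_one]
  exact pow_le_one₀ (by positivity) (inv_le_one_of_one_le₀ h)

lemma mul_inv_one_add_sq_mem_finiteElements (R : FieldOrdering K) (a : K) :
    a * (1 + a ^ 2)⁻¹ ∈ R.finiteElements := by
  let := R.linearOrder
  have := R.isStrictOrderedRing
  refine R.mem_finiteElements_of_sq_le (q := 1) ?_
  change (a * (1 + a ^ 2)⁻¹) ^ 2 ≤ ((1 : ℚ) : K)
  rw [Rat.cast_one, ← div_eq_mul_inv, div_pow, div_le_one (by positivity)]
  nlinarith [sq_nonneg a, sq_nonneg (a ^ 2)]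

/-- A real place is determined by its values on the real holomorphy ring, because the value at `a`
can be read off from those at `1 / (1 + a ^ 2)` and `a / (1 + a ^ 2)`. -/
theorem realPlace_eq_ite (R : FieldOrdering K) (a : K) :
    R.realPlace a = if R.stdPart (1 + a ^ 2)⁻¹ = 0 then OnePoint.infty
      else ((R.stdPart (a * (1 + a ^ 2)⁻¹) / R.stdPart (1 + a ^ 2)⁻¹ : ℝ) : OnePoint ℝ) := by
  have hu := R.inv_one_add_sq_mem_finiteElements a
  by_cases ha : a ∈ R.finiteElements
  · have hne : R.stdPart (1 + a ^ 2)⁻¹ ≠ 0 := by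
      have h1 : (1 : K) ∈ R.finiteElements := by simpa using R.ratCast_mem_finiteElements 1
      have h1' : R.stdPart (1 : K) = 1 := by simpa using R.stdPart_ratCast 1
      rw [stdPart_inv, sq, R.stdPart_add h1 (R.mul_mem_finiteElements ha ha), R.stdPart_mul ha ha,
        h1']
      exact inv_ne_zero (by nlinarith [mul_self_nonneg (R.stdPart a)])
    rw [if_neg hne, R.realPlace_of_mem ha, R.stdPart_mul ha hu, mul_div_cancel_right₀ _ hne]
  · rw [R.realPlace_of_notMem ha, if_pos]
    by_contra hne
    refine ha ?_
    rw [stdPart_inv, inv_eq_zero] at hne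
    obtain ⟨r, -, hr⟩ := R.mem_finiteElements_of_stdPart_ne_zero hne
    let := R.linearOrder
    have := R.isStrictOrderedRing
    exact R.mem_finiteElements_of_sq_le (q := r)
      (le_trans (le_add_of_nonneg_left zero_le_one) (show 1 + a ^ 2 ≤ (r : K) from hr))

end FieldOrdering

namespace RealPlaceSpace

variable {K : Type*} [Field K]

theorem exists_value_ne {l m : RealPlaceSpace K} (h : l ≠ m) :
    ∃ a ∈ realHolomorphyRing K, value l a ≠ value m a := by
  contrapose! h
  refine Subtype.ext (funext fun a => ?_)
  have hu := h _ fun R => R.inv_one_add_sq_mem_finiteElements a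
  have hv := h _ fun R => R.mul_inv_one_add_sq_mem_finiteElements a
  rw [← l.2.choose_spec, ← m.2.choose_spec, FieldOrdering.realPlace_eq_ite,
    FieldOrdering.realPlace_eq_ite]
  unfold value at hu hv
  rw [hu, hv]

/-- The closure of the real holomorphy ring in the continuous functions on the space of real places.
It is an algebra over `ℝ` because the holomorphy ring contains `ℚ`. -/
noncomputable def holomorphyClosure (K : Type*) [Field K] :
    Subalgebra ℝ C(RealPlaceSpace K, ℝ) where
  __ := (valueHom K).range.topologicalClosure
  algebraMap_mem' r := by
    have hcont : Continuous (algebraMap ℝ C(RealPlaceSpace K, ℝ)) := continuous_algebraMap _ _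
    have hmem : r ∈ closure (Set.range ((↑) : ℚ → ℝ)) := Rat.denseRange_cast r
    refine map_mem_closure hcont hmem ?_
    rintro _ ⟨q, rfl⟩
    refine ⟨⟨q, fun R => R.ratCast_mem_finiteElements q⟩, ?_⟩
    ext l
    exact l.2.choose.stdPart_ratCast q

/-- By the Stone–Weierstrass theorem, every continuous real function on the space of real places is
a uniform limit of functions given by elements of the real holomorphy ring. -/
theorem exists_value_close (f : C(RealPlaceSpace K, ℝ)) {ε : ℝ} (hε : 0 < ε) :
    ∃ a ∈ realHolomorphyRing K, ∀ l, |value l a - f l| < ε := by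
  have hsep : (holomorphyClosure K).SeparatesPoints := by
    intro l m hlm
    obtain ⟨a, ha, hne⟩ := exists_value_ne hlm
    exact ⟨_, ⟨valueHom K ⟨a, ha⟩,
      Subring.le_topologicalClosure _ ⟨⟨a, ha⟩, rfl⟩, rfl⟩, hne⟩
  have htop := ContinuousMap.subalgebra_topologicalClosure_eq_top_of_separatesPoints _ hsep
  have hf : f ∈ closure ((holomorphyClosure K : Subalgebra ℝ _) : Set C(RealPlaceSpace K, ℝ)) := by
    have : f ∈ (holomorphyClosure K).topologicalClosure := htop ▸ Algebra.mem_top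
    exact this
  have hclosed : closure ((holomorphyClosure K : Subalgebra ℝ _) : Set C(RealPlaceSpace K, ℝ)) =
      closure ((valueHom K).range : Set C(RealPlaceSpace K, ℝ)) := closure_closure
  rw [hclosed, Metric.mem_closure_iff] at hf
  obtain ⟨_, ⟨a, rfl⟩, ha⟩ := hf ε hε
  refine ⟨a, a.2, fun l => ?_⟩
  rw [abs_sub_comm]
  exact (ContinuousMap.dist_apply_le_dist l).trans_lt ha

/-! ### Clopen sets of real places and signs -/

/-- A clopen set of real places is the positivity set of an element of the real holomorphy ring whose
values are so close to `±1` that its square is a sum of fourth powers. -/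
theorem exists_sq_mem_sumsOfFourthPowers {U : Set (RealPlaceSpace K)} (hU : IsClopen U)
    {P Q : FieldOrdering K} (hP : ofOrdering P ∈ U) (hQ : ofOrdering Q ∉ U) :
    ∃ b : K, b ≠ 0 ∧ b ∈ P.nonneg ∧ -b ∈ Q.nonneg ∧ b ^ 2 ∈ sumsOfFourthPowers K := by
  classical
  let f : C(RealPlaceSpace K, ℝ) :=
    ⟨U.indicator (fun _ => 2) - 1,
      (continuous_const.indicator (by simp [hU.frontier_eq])).sub continuous_const⟩
  have hfU : ∀ l ∈ U, f l = 1 := fun l hl => by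
    change U.indicator (fun _ => (2 : ℝ)) l - 1 = 1
    rw [Set.indicator_of_mem hl]
    norm_num
  have hfU' : ∀ l ∉ U, f l = -1 := fun l hl => by
    change U.indicator (fun _ => (2 : ℝ)) l - 1 = -1
    rw [Set.indicator_of_notMem hl]
    norm_num
  obtain ⟨b, hb, hclose⟩ := exists_value_close f (ε := 1 / 20) (by norm_num)
  have hbP := hclose (ofOrdering P)
  have hbQ := hclose (ofOrdering Q)
  rw [hfU _ hP, value_ofOrdering hb, abs_lt] at hbP
  rw [hfU' _ hQ, value_ofOrdering hb, abs_lt] at hbQ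
  refine ⟨b, ?_, P.mem_nonneg_of_stdPart_pos (by linarith), Q.mem_nonneg_of_stdPart_pos ?_, ?_⟩
  · rintro rfl
    have := P.stdPart_ratCast 0
    norm_num at this
    linarith
  · rw [Q.stdPart_neg]
    linarith
  · refine P.mem_sumsOfFourthPowers_of_close_to_one fun R => ?_
    have hbR := hclose (ofOrdering R)
    rw [value_ofOrdering hb] at hbR
    have hmem := R.mul_mem_finiteElements (hb R) (hb R)
    -- `0.95 ^ 2 > 6 / 7` and `1.05 ^ 2 < 8 / 7`.
    have hbd : ((6 / 7 : ℚ) : ℝ) < R.stdPart (b * b) ∧ R.stdPart (b * b) < ((8 / 7 : ℚ) : ℝ) := by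
      rw [R.stdPart_mul (hb R) (hb R)]
      push_cast
      by_cases hR : ofOrdering R ∈ U
      · rw [hfU _ hR, abs_lt] at hbR
        constructor <;> nlinarith
      · rw [hfU' _ hR, abs_lt] at hbR
        constructor <;> nlinarith
    rw [sq]
    exact ⟨R.ratCast_le_of_lt_stdPart hmem hbd.1, R.le_ratCast_of_stdPart_lt hmem hbd.2⟩

/-- If `b ^ 2` is a sum of fourth powers, the orderings at which `b` is positive have as their real
places a clopen set, given by the positivity of a unit of the holomorphy ring. -/
theorem connectedComponent_ne_of_sq_mem_sumsOfFourthPowers {P Q : FieldOrdering K} {b : K}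
    (hb : b ≠ 0) (hP : b ∈ P.nonneg) (hQ : -b ∈ Q.nonneg) (h : b ^ 2 ∈ sumsOfFourthPowers K) :
    connectedComponent (ofOrdering P) ≠ connectedComponent (ofOrdering Q) := by
  obtain ⟨u, hu⟩ := FieldOrdering.exists_unit_of_sq_mem_sumsOfFourthPowers hb h
  have huH : u ∈ realHolomorphyRing K := fun R => (hu R).1
  have hcont := continuous_value huH
  have hclopen : IsClopen {l : RealPlaceSpace K | 0 < value l u} := by
    refine ⟨?_, isOpen_lt continuous_const hcont⟩
    have : {l : RealPlaceSpace K | 0 < value l u} = {l | 0 ≤ value l u} := by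
      ext l
      simp only [Set.mem_ofPred_eq]
      exact ⟨le_of_lt, fun hl => hl.lt_of_ne' (hu _).2.1⟩
    rw [this]
    exact isClosed_le continuous_const hcont
  intro heq
  have hmemP : ofOrdering P ∈ {l : RealPlaceSpace K | 0 < value l u} := by
    rw [Set.mem_ofPred_eq, value_ofOrdering huH]
    exact (hu P).2.2.1 hP
  have hmemQ := hclopen.connectedComponent_subset hmemP
    (heq ▸ mem_connectedComponent : ofOrdering Q ∈ connectedComponent (ofOrdering P))
  rw [Set.mem_ofPred_eq, value_ofOrdering huH] at hmemQ
  exact hmemQ.not_gt ((hu Q).2.2.2 hQ)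

end RealPlaceSpace

theorem mainTheorem3 {K : Type*} [Field K] (P Q : FieldOrdering K) :
    connectedComponent (RealPlaceSpace.ofOrdering P) ≠
        connectedComponent (RealPlaceSpace.ofOrdering Q) ↔
      ∃ b : K, b ≠ 0 ∧ b ∈ P.nonneg ∧ -b ∈ Q.nonneg ∧ b ^ 2 ∈ sumsOfFourthPowers K := by
  refine ⟨fun h => ?_, fun ⟨b, hb, hP, hQ, h⟩ =>
    RealPlaceSpace.connectedComponent_ne_of_sq_mem_sumsOfFourthPowers hb hP hQ h⟩
  -- In a compact Hausdorff space distinct components are separated by a clopen set.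
  have hQP : RealPlaceSpace.ofOrdering Q ∉ connectedComponent (RealPlaceSpace.ofOrdering P) :=
    fun hmem => h (connectedComponent_eq hmem)
  rw [connectedComponent_eq_iInter_isClopen, Set.mem_iInter] at hQP
  push Not at hQP
  obtain ⟨⟨U, hU, hPU⟩, hQU⟩ := hQP
  exact RealPlaceSpace.exists_sq_mem_sumsOfFourthPowers hU hPU hQU
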